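/- Let $N\ge 1$ be an integer. An eta-product is a function $\prod_{d}\eta(d\tau)^{m_d}$ on the upper half-plane $\mathfrak h$, where $d$ runs over finitely many positive integers, $m_d\in\mathbb Z$, and $\eta(\tau)=e^{2\pi i\tau/24}\prod_{k\ge1}(1-e^{2\pi i k\tau})$. A modular function on $\Gamma=\Gamma_0(N)$ is a function on $\mathfrak h$ that is invariant under $\Gamma$, meromorphic on $\mathfrak h$, and meromorphic at every cusp $s\in\mathbb Q\cup\{\infty\}$. For such a function $f$ and a cusp $s=\gamma\infty$ with $\gamma\in\mathrm{SL}_2(\mathbb Z)$, let $\kappa$ be the fan width of $\Gamma$ at $s$, that is, the least integer $h\ge1$ with $\pm\gamma\begin{pmatrix}1&h\\0&1\end{pmatrix}\gamma^{-1}\in\Gamma$, and let $\mathrm{ORD}(f,s,\Gamma)\in\mathbb Z\cup\{\infty\}$ be the order of vanishing of $f(\gamma\tau)$ in the local parameter $e^{2\pi i\tau/\kappa}$ (equivalently, $\kappa$ times the exponent of the leading power of $q=e^{2\pi i\tau}$ in the expansion of $f(\gamma\tau)$), with $\mathrm{ORD}(0,s,\Gamma)=\infty$. Let $f_1,\dots,f_n$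 be eta-products that are modular functions on $\Gamma_0(N)$, let $\mathcal S_N$ be a complete set of inequivalent cusps for $\Gamma_0(N)$, and put $$B=\sum_{\substack{s\in\mathcal S_N\\ s\not\sim\infty}}\min\bigl(\{\mathrm{ORD}(f_j,s,\Gamma_0(N)) : 1\le j\le n\}\cup\{0\}\bigr),$$ where the sum is over those $s\in\mathcal S_N$ that are not $\Gamma_0(N)$-equivalent to $\infty$. Let $\alpha_1,\dots,\alpha_n\in\mathbb C$ and $$g(\tau)=\alpha_1f_1(\tau)+\cdots+\alpha_nf_n(\tau)+1 .$$ Then $g$ vanishes identically on $\mathfrak h$ if and only if $\mathrm{ORD}(g,\infty,\Gamma_0(N))>-B$. -/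

import Mathlib

open scoped MatrixGroups
open UpperHalfPlane

namespace EtaProducts

noncomputable section

/-- The eta-product `∏ η(d τ) ^ (m d)` attached to a finitely supported family of integer exponents
`m d`, where `d` ranges over the positive integers. -/
def etaProduct (m : ℕ+ →₀ ℤ) (τ : ℍ) : ℂ :=
  m.prod fun d k => ModularForm.eta ((d : ℂ) * (τ : ℂ)) ^ k

/-- `f` is an eta-product. -/
def IsEtaProduct (f : ℍ → ℂ) : Prop :=
  ∃ m : ℕ+ →₀ ℤ, f = etaProduct m

/-- Two cusps in `ℚ ∪ {∞}` are equivalent under `Γ` if they lie in the same `Γ`-orbit. -/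
def CuspEquiv (Γ : Subgroup SL(2, ℤ)) (s t : OnePoint ℚ) : Prop :=
  ∃ γ ∈ Γ, Matrix.SpecialLinearGroup.mapGL ℚ γ • s = t

/-- `S` is a complete set of inequivalent cusps for `Γ`. -/
def IsCompleteSetOfCusps (Γ : Subgroup SL(2, ℤ)) (S : Finset (OnePoint ℚ)) : Prop :=
  ∀ c : OnePoint ℚ, ∃! s : OnePoint ℚ, s ∈ S ∧ CuspEquiv Γ s c

/-- The fan width of `Γ` at the cusp `γ ∞`: the least integer `h ≥ 1` such that
`± γ [1, h; 0, 1] γ⁻¹ ∈ Γ`. -/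
def fanWidth (Γ : Subgroup SL(2, ℤ)) (γ : SL(2, ℤ)) : ℕ :=
  sInf {h : ℕ | 0 < h ∧
    (γ * ModularGroup.T ^ h * γ⁻¹ ∈ Γ ∨ -(γ * ModularGroup.T ^ h * γ⁻¹) ∈ Γ)}

/-- The expansion of a `Γ`-invariant function `f` at the cusp `γ ∞`, i.e. the function `F` on the
punctured unit disc with `f (γ τ) = F (exp (2 π i τ / κ))`, where `κ` is the fan width. -/
def cuspExpansion (Γ : Subgroup SL(2, ℤ)) (f : ℍ → ℂ) (γ : SL(2, ℤ)) : ℂ → ℂ :=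
  cuspFunction (fanWidth Γ γ : ℝ) fun τ : ℍ => f (γ • τ)

/-- Modular functions on `Γ`: functions that are `Γ`-invariant, meromorphic on the upper half-plane,
and meromorphic at all cusps. -/
structure IsModularFunction (Γ : Subgroup SL(2, ℤ)) (f : ℍ → ℂ) : Prop where
  invariant : ∀ γ ∈ Γ, ∀ τ : ℍ, f (γ • τ) = f τ
  meromorphic : MeromorphicOn (f ∘ ofComplex) {z : ℂ | 0 < z.im}
  meromorphic_cusps : ∀ γ : SL(2, ℤ), MeromorphicAt (cuspExpansion Γ f γ) 0

/-- A matrix of `SL(2, ℤ)` that maps `∞` to the given cusp. -/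
def cuspMatrix (s : OnePoint ℚ) : SL(2, ℤ) :=
  (OnePoint.exists_mem_SL2 (K := ℚ) ℤ s).choose

/-- The order `ORD(f, s, Γ)` of `f` at the cusp `s = γ ∞` with respect to `Γ`: the order of `f ∘ γ`
in the local parameter `q ^ (1 / κ) = exp (2 π i τ / κ)`, where `κ` is the fan width of `Γ` at `s`.
In other words it is `κ * ν` if `q ^ ν`, with `ν ∈ (1 / κ) ℤ`, is the leading power of
`q = exp (2 π i τ)` in the expansion of `f ∘ γ`; it is `⊤` for `f = 0`. -/
def ORD (Γ : Subgroup SL(2, ℤ)) (f : ℍ → ℂ) (s : OnePoint ℚ) : WithTop ℤ :=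
  meromorphicOrderAt (cuspExpansion Γ f (cuspMatrix s)) 0

/-- The integer `min ({ORD(f_j, s, Γ) : j} ∪ {0})`. -/
def minORD (Γ : Subgroup SL(2, ℤ)) {n : ℕ} (f : Fin n → ℍ → ℂ) (s : OnePoint ℚ) : ℤ :=
  (min 0 (Finset.univ.inf fun j => ORD Γ (f j) s)).untop
    (ne_of_lt (lt_of_le_of_lt (min_le_left _ _) (WithTop.coe_lt_top (0 : ℤ))))

open Classical in
/-- The constant `B`: the sum of `min ({ORD(f_j, s, Γ) : j} ∪ {0})` over the cusps `s ∈ S` other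
than the one equivalent to `∞`. -/
def boundB (Γ : Subgroup SL(2, ℤ)) (S : Finset (OnePoint ℚ)) {n : ℕ} (f : Fin n → ℍ → ℂ) : ℤ :=
  ∑ s ∈ S with ¬ CuspEquiv Γ s OnePoint.infty, minORD Γ f s

end

end EtaProducts

namespace EtaProducts

open Filter Topology Asymptotics Matrix.SpecialLinearGroup ModularGroup
open scoped Manifold Real ModularForm

/-! Since `η` has no zeros on `ℍ`, eta-products, and hence `g`, are holomorphic there, so only the
cusps matter. Away from `∞`, `g` has order at least `minORD`, which sums to `B`; if its order at `∞`
exceeds `-B`, the total is at least `1`.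

A nonzero `g` would contradict the valence formula. This is shown through the norm `∏ g(γ⁻¹τ)` over
cosets `γΓ` of `SL(2, ℤ)` (`eq_zero_of_isBigO_exp_at_cusps`): it is holomorphic of level one and
weight zero. A cusp of width `κ` accounts for `κ` cosets, each contributing `ord / κ` in powers of
`q` (`sum_cosetCusp`), so the norm vanishes at `∞`. Being constant, it is zero, hence so is one
factor, hence `g`. -/

lemma mdifferentiable_etaProduct (m : ℕ+ →₀ ℤ) : MDiff (etaProduct m) := by
  rw [mdifferentiable_iff]
  have key : DifferentiableOn ℂ
      (fun z : ℂ => ∏ d ∈ m.support, ModularForm.eta (((d : ℕ) : ℂ) * z) ^ m d)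
      {z | 0 < z.im} := by
    refine DifferentiableOn.fun_finsetProd fun d _ z hz => ?_
    have hd : ((d : ℕ) : ℂ) * z ∈ upperHalfPlaneSet := by
      have h0 : (0 : ℝ) < ((d : ℕ) : ℝ) := by exact_mod_cast d.pos
      simpa using mul_pos h0 hz
    have h1 : DifferentiableAt ℂ (fun w : ℂ => ModularForm.eta (((d : ℕ) : ℂ) * w)) z :=
      DifferentiableAt.fun_comp' z (ModularForm.differentiableAt_eta_of_mem_upperHalfPlaneSet hd)
        (by fun_prop)
    exact (h1.zpow (Or.inl (ModularForm.eta_ne_zero hd))).differentiableWithinAt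
  refine key.congr fun z hz => ?_
  simp [etaProduct, Finsupp.prod, ofComplex_apply_of_im_pos hz]

/-! ### From orders to exponential growth bounds. -/

lemma isBigO_zpow_of_le_meromorphicOrderAt {F : ℂ → ℂ} (hF : MeromorphicAt F 0) {k : ℤ}
    (hk : (k : WithTop ℤ) ≤ meromorphicOrderAt F 0) :
    F =O[𝓝[≠] 0] fun z => z ^ k := by
  have hz : MeromorphicAt (fun z : ℂ => z ^ (-k)) 0 := by fun_prop
  have hord : meromorphicOrderAt (fun z : ℂ => z ^ (-k)) 0 = ((-k : ℤ) : WithTop ℤ) := by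
    simpa using fun_meromorphicOrderAt_zpow_id_sub_const (𝕜 := ℂ) (x := 0) (n := -k)
  have hnn : 0 ≤ meromorphicOrderAt (fun z => z ^ (-k) * F z) 0 := by
    rw [fun_meromorphicOrderAt_mul hz hF, hord]
    calc (0 : WithTop ℤ) = ((-k : ℤ) : WithTop ℤ) + (k : WithTop ℤ) := by
          rw [← WithTop.coe_add]; simp
      _ ≤ _ := by gcongr
  obtain ⟨c, hc⟩ := tendsto_nhds_of_meromorphicOrderAt_nonneg (hz.fun_mul hF) hnn
  have h1 := (isBigO_refl (fun z : ℂ => z ^ k) (𝓝[≠] 0)).mul (hc.isBigO_one ℂ)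
  refine (h1.congr' ?_ ?_)
  · filter_upwards [self_mem_nhdsWithin] with z hz
    have : z ≠ 0 := hz
    rw [← mul_assoc, ← zpow_add₀ this]; simp
  · filter_upwards with z; simp

lemma isBigO_exp_of_le_meromorphicOrderAt_cuspFunction {f : ℍ → ℂ} {h : ℝ} (hh : 0 < h)
    (hper : ∀ τ, f (h +ᵥ τ) = f τ) (hF : MeromorphicAt (cuspFunction h f) 0) {k : ℤ}
    (hk : (k : WithTop ℤ) ≤ meromorphicOrderAt (cuspFunction h f) 0) :
    f =O[atImInfty] fun τ => Real.exp (-2 * π * (k / h) * τ.im) := by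
  have hper' : Function.Periodic (f ∘ ofComplex) h := by
    intro z
    rcases lt_or_ge 0 z.im with hz | hz
    · have hz' : 0 < (z + (h : ℂ)).im := by simpa using hz
      simp only [Function.comp_apply, ofComplex_apply_of_im_pos hz,
        ofComplex_apply_of_im_pos hz']
      rw [← hper ⟨z, hz⟩]
      congr 1
      ext
      simp [add_comm]
    -- Off the upper half-plane `ofComplex` takes one default value, so periodicity is trivial.
    · have hz' : (z + (h : ℂ)).im ≤ 0 := by simpa using hz
      simp only [Function.comp_apply, ofComplex_apply_of_im_nonpos hz,
        ofComplex_apply_of_im_nonpos hz']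
  have ht : Tendsto (fun τ : ℍ => Function.Periodic.qParam h (τ : ℂ)) atImInfty (𝓝[≠] 0) :=
    (Function.Periodic.qParam_tendsto hh).comp tendsto_coe_atImInfty
  refine (((isBigO_zpow_of_le_meromorphicOrderAt hF hk).comp_tendsto ht).congr_left
    fun τ => eq_cuspFunction τ hh.ne' hper').trans (isBigO_of_le _ fun τ => le_of_eq ?_)
  simp only [Function.comp_apply, norm_zpow, Function.Periodic.norm_qParam, Real.norm_eq_abs,
    Real.abs_exp, ← Real.rpow_intCast, ← Real.exp_mul]
  congr 1
  simp only [coe_im]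
  ring

/-! ### Cusp equivalence and fan widths. -/

lemma exists_eq_T_zpow_or_neg_of_smul_infty {γ : SL(2, ℤ)}
    (h : mapGL ℚ γ • (OnePoint.infty : OnePoint ℚ) = OnePoint.infty) :
    ∃ m : ℤ, γ = T ^ m ∨ γ = -T ^ m := by
  rw [OnePoint.smul_infty_eq_self_iff] at h
  have hc : γ 1 0 = 0 := by simpa using h
  have had := γ.det_coe
  replace had : γ 0 0 * γ 1 1 = 1 := by rw [Matrix.det_fin_two, hc] at had; lia
  rcases Int.eq_one_or_neg_one_of_mul_eq_one' had with (⟨ha, hd⟩ | ⟨ha, hd⟩)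
  · refine ⟨γ 0 1, Or.inl ?_⟩
    ext i j; fin_cases i <;> fin_cases j <;>
      simp [ha, hc, hd, coe_T_zpow, show (1 : Fin (0 + 2)) = (1 : Fin 2) from rfl]
  · refine ⟨-(γ 0 1), Or.inr ?_⟩
    ext i j; fin_cases i <;> fin_cases j <;>
      simp [ha, hc, hd, coe_T_zpow, show (1 : Fin (0 + 2)) = (1 : Fin 2) from rfl]

lemma T_zpow_smul_infty (m : ℤ) :
    mapGL ℚ (T ^ m) • (OnePoint.infty : OnePoint ℚ) = OnePoint.infty := by
  rw [OnePoint.smul_infty_eq_self_iff]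
  simp only [mapGL_coe_matrix, RingHom.mapMatrix_apply, map_apply_coe, Matrix.map_apply,
    coe_T_zpow]
  simp

lemma cuspMatrix_smul_infty (s : OnePoint ℚ) :
    mapGL ℚ (cuspMatrix s) • (OnePoint.infty : OnePoint ℚ) = s :=
  (OnePoint.exists_mem_SL2 (K := ℚ) ℤ s).choose_spec

section Cusps

variable {Γ : Subgroup SL(2, ℤ)}

lemma neg_mem_iff_of_neg_one_mem (hneg : (-1 : SL(2, ℤ)) ∈ Γ) {γ : SL(2, ℤ)} :
    -γ ∈ Γ ↔ γ ∈ Γ := by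
  rw [← neg_one_mul γ, Γ.mul_mem_cancel_left hneg]

lemma exists_eq_mul_T_zpow_of_cuspEquiv (hneg : (-1 : SL(2, ℤ)) ∈ Γ) {γ γ' : SL(2, ℤ)}
    (h : CuspEquiv Γ (mapGL ℚ γ • OnePoint.infty) (mapGL ℚ γ' • OnePoint.infty)) :
    ∃ δ ∈ Γ, ∃ m : ℤ, γ' = δ * γ * T ^ m := by
  obtain ⟨δ, hδ, h⟩ := h
  have h1 : mapGL ℚ ((δ * γ)⁻¹ * γ') • (OnePoint.infty : OnePoint ℚ) = OnePoint.infty := by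
    rw [map_mul, mul_smul, ← h, map_inv, map_mul, inv_smul_eq_iff, mul_smul]
  obtain ⟨m, hm | hm⟩ := exists_eq_T_zpow_or_neg_of_smul_infty h1
  · exact ⟨δ, hδ, m, by rw [← hm]; group⟩
  -- The sign is absorbed into `δ`, because `-1 ∈ Γ`.
  · refine ⟨-δ, (neg_mem_iff_of_neg_one_mem hneg).2 hδ, m, ?_⟩
    rw [neg_mul, neg_mul, ← mul_neg, ← hm]; group

lemma cuspEquiv_mul_T_zpow {δ : SL(2, ℤ)} (hδ : δ ∈ Γ) (γ : SL(2, ℤ)) (m : ℤ) :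
    CuspEquiv Γ (mapGL ℚ γ • OnePoint.infty)
      (mapGL ℚ (δ * γ * T ^ m) • OnePoint.infty) :=
  ⟨δ, hδ, by rw [map_mul, mul_smul, T_zpow_smul_infty, map_mul, mul_smul]⟩

lemma CuspEquiv.symm {s t : OnePoint ℚ} (h : CuspEquiv Γ s t) : CuspEquiv Γ t s := by
  obtain ⟨δ, hδ, h⟩ := h
  exact ⟨δ⁻¹, Γ.inv_mem hδ, by rw [map_inv, inv_smul_eq_iff, h]⟩

lemma CuspEquiv.trans {s t u : OnePoint ℚ} (h : CuspEquiv Γ s t) (h' : CuspEquiv Γ t u) :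
    CuspEquiv Γ s u := by
  obtain ⟨δ, hδ, h⟩ := h
  obtain ⟨δ', hδ', h'⟩ := h'
  exact ⟨δ' * δ, Γ.mul_mem hδ' hδ, by rw [map_mul, mul_smul, h, h']⟩

lemma fanWidth_eq_sInf (hneg : (-1 : SL(2, ℤ)) ∈ Γ) (γ : SL(2, ℤ)) :
    fanWidth Γ γ = sInf {h : ℕ | 0 < h ∧ γ * T ^ h * γ⁻¹ ∈ Γ} := by
  simp only [fanWidth, neg_mem_iff_of_neg_one_mem hneg, or_self]

lemma fanWidth_mul_T_zpow {δ : SL(2, ℤ)} (hδ : δ ∈ Γ) (hneg : (-1 : SL(2, ℤ)) ∈ Γ)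
    (γ : SL(2, ℤ)) (m : ℤ) : fanWidth Γ (δ * γ * T ^ m) = fanWidth Γ γ := by
  simp only [fanWidth_eq_sInf hneg]
  congr! 4 with h
  have : δ * γ * T ^ m * T ^ h * (δ * γ * T ^ m)⁻¹ = δ * (γ * T ^ h * γ⁻¹) * δ⁻¹ := by
    group
  rw [this, Γ.mul_mem_cancel_right (Γ.inv_mem hδ), Γ.mul_mem_cancel_left hδ]

/-! ### Cosets of `Γ` sorted by cusps. -/

variable {S : Finset (OnePoint ℚ)}

/-- The element of `S` equivalent to the cusp `γ⁻¹ ∞`, as a function of the coset `γ Γ`. -/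
noncomputable def cosetCusp (hS : IsCompleteSetOfCusps Γ S) (q : SL(2, ℤ) ⧸ Γ) : OnePoint ℚ :=
  (hS (mapGL ℚ q.out⁻¹ • OnePoint.infty)).choose

lemma cosetCusp_mem (hS : IsCompleteSetOfCusps Γ S) (q : SL(2, ℤ) ⧸ Γ) : cosetCusp hS q ∈ S :=
  (hS (mapGL ℚ q.out⁻¹ • OnePoint.infty)).choose_spec.1.1

lemma cosetCusp_mk_eq_iff (hS : IsCompleteSetOfCusps Γ S) {s : OnePoint ℚ} (hs : s ∈ S)
    (γ : SL(2, ℤ)) :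
    cosetCusp hS (γ : SL(2, ℤ) ⧸ Γ) = s ↔ CuspEquiv Γ s (mapGL ℚ γ⁻¹ • OnePoint.infty) := by
  obtain ⟨δ, hδ⟩ := QuotientGroup.mk_out_eq_mul Γ γ
  have hspec := (hS (mapGL ℚ (γ : SL(2, ℤ) ⧸ Γ).out⁻¹ • OnePoint.infty)).choose_spec
  have hout : CuspEquiv Γ (mapGL ℚ (γ : SL(2, ℤ) ⧸ Γ).out⁻¹ • OnePoint.infty)
      (mapGL ℚ γ⁻¹ • OnePoint.infty) :=
    ⟨δ, δ.2, by rw [hδ, ← mul_smul, ← map_mul]; simp⟩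
  refine ⟨fun h => h ▸ hspec.1.2.trans hout, fun h => ?_⟩
  exact (hspec.2 s ⟨hs, h.trans hout.symm⟩).symm

lemma tendsto_T_zpow_smul_atImInfty (m : ℤ) :
    Tendsto (fun τ : ℍ => T ^ m • τ) atImInfty atImInfty := by
  simpa only [atImInfty, tendsto_comap_iff, Function.comp_def, im_T_zpow_smul] using
    tendsto_comap

lemma isBigO_exp_mul_T_zpow_smul {g : ℍ → ℂ} (hinv : ∀ γ ∈ Γ, ∀ τ : ℍ, g (γ • τ) = g τ)
    {γ δ : SL(2, ℤ)} (hδ : δ ∈ Γ) (m : ℤ) {c : ℝ}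
    (h : (fun τ => g (γ • τ)) =O[atImInfty] fun τ => Real.exp (-2 * π * c * τ.im)) :
    (fun τ => g ((δ * γ * T ^ m) • τ)) =O[atImInfty] fun τ => Real.exp (-2 * π * c * τ.im) := by
  have := h.comp_tendsto (tendsto_T_zpow_smul_atImInfty m)
  simpa only [Function.comp_def, im_T_zpow_smul, mul_smul, hinv δ hδ] using this

variable [Γ.FiniteIndex]

lemma fanWidth_spec (hneg : (-1 : SL(2, ℤ)) ∈ Γ) (γ : SL(2, ℤ)) :
    0 < fanWidth Γ γ ∧ γ * T ^ fanWidth Γ γ * γ⁻¹ ∈ Γ := by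
  rw [fanWidth_eq_sInf hneg]
  refine Nat.sInf_mem (s := {h : ℕ | 0 < h ∧ γ * T ^ h * γ⁻¹ ∈ Γ}) ?_
  obtain ⟨n, hn, -, h⟩ := Γ.exists_pow_mem_of_index_ne_zero
    Subgroup.FiniteIndex.index_ne_zero (γ * T * γ⁻¹)
  exact ⟨n, hn, by rwa [conj_pow] at h⟩

lemma conj_T_zpow_mem_iff (hneg : (-1 : SL(2, ℤ)) ∈ Γ) (γ : SL(2, ℤ)) (m : ℤ) :
    γ * T ^ m * γ⁻¹ ∈ Γ ↔ (fanWidth Γ γ : ℤ) ∣ m := by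
  obtain ⟨hpos, hmem⟩ := fanWidth_spec hneg γ
  have hmul (j : ℤ) : γ * T ^ ((fanWidth Γ γ : ℤ) * j) * γ⁻¹ ∈ Γ := by
    rw [zpow_mul, ← conj_zpow, zpow_natCast]
    exact Γ.zpow_mem hmem j
  refine ⟨fun h => ?_, fun ⟨j, hj⟩ => hj ▸ hmul j⟩
  by_contra hdvd
  have hpos' : (0 : ℤ) < fanWidth Γ γ := by exact_mod_cast hpos
  have hr0 := Int.emod_nonneg m hpos'.ne'
  have hr1 := Int.emod_lt_of_pos m hpos'
  obtain ⟨r, hr⟩ := Int.eq_ofNat_of_zero_le hr0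
  have hr' : 0 < r := by
    rcases Nat.eq_zero_or_pos r with h0 | h0
    · exact absurd (Int.dvd_of_emod_eq_zero (by simpa [h0] using hr)) hdvd
    · exact h0
  -- A nonzero remainder of `m` modulo the width would contradict the minimality of the width.
  have hrmem : γ * T ^ r * γ⁻¹ ∈ Γ := by
    have h2 := Γ.mul_mem h (Γ.inv_mem (hmul (m / fanWidth Γ γ)))
    have h3 : γ * T ^ m * γ⁻¹ * (γ * T ^ ((fanWidth Γ γ : ℤ) * (m / fanWidth Γ γ)) * γ⁻¹)⁻¹
        = γ * T ^ (m - (fanWidth Γ γ : ℤ) * (m / fanWidth Γ γ)) * γ⁻¹ := by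
      rw [zpow_sub]; group
    rw [h3, ← Int.emod_def, hr] at h2
    simpa using h2
  have := Nat.sInf_le (s := {h : ℕ | 0 < h ∧ γ * T ^ h * γ⁻¹ ∈ Γ}) ⟨hr', hrmem⟩
  rw [← fanWidth_eq_sInf hneg] at this
  omega

/-- With `σ = cuspMatrix s`, the fiber consists of the cosets `T ^ j σ⁻¹ Γ`, and two of them agree
exactly when their `j` are congruent modulo the width. -/
lemma card_cosetCusp_fiber [Fintype (SL(2, ℤ) ⧸ Γ)] (hneg : (-1 : SL(2, ℤ)) ∈ Γ)
    (hS : IsCompleteSetOfCusps Γ S) [DecidableEq (OnePoint ℚ)] {s : OnePoint ℚ} (hs : s ∈ S) :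
    (Finset.univ.filter fun q => cosetCusp hS q = s).card = fanWidth Γ (cuspMatrix s) := by
  obtain ⟨hpos, -⟩ := fanWidth_spec hneg (cuspMatrix s)
  set h := fanWidth Γ (cuspMatrix s) with hh
  have hpos' : (0 : ℤ) < h := by exact_mod_cast hpos
  have hmk (i j : ℤ) : ((T ^ i * (cuspMatrix s)⁻¹ : SL(2, ℤ)) : SL(2, ℤ) ⧸ Γ) =
      (T ^ j * (cuspMatrix s)⁻¹ : SL(2, ℤ)) ↔ (h : ℤ) ∣ j - i := by
    rw [QuotientGroup.eq, ← conj_T_zpow_mem_iff hneg]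
    congr! 1
    group
  rw [← Finset.card_range h]
  symm
  refine Finset.card_nbij
    (fun j : ℕ => ((T ^ (j : ℤ) * (cuspMatrix s)⁻¹ : SL(2, ℤ)) : SL(2, ℤ) ⧸ Γ)) ?_ ?_ ?_
  · intro j _
    simp only [Finset.coe_filter, Finset.mem_univ, true_and, Set.mem_ofPred_eq]
    rw [cosetCusp_mk_eq_iff hS hs]
    have := cuspEquiv_mul_T_zpow Γ.one_mem (cuspMatrix s) (-(j : ℤ))
    rw [cuspMatrix_smul_infty] at this
    simpa using this
  · intro i hi j hj hij
    simp only [Finset.coe_range, Set.mem_Iio] at hi hj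
    have hd := (hmk i j).1 hij
    have := Int.eq_zero_of_abs_lt_dvd hd (by rw [abs_lt]; omega)
    omega
  · intro q hq
    induction q using QuotientGroup.induction_on with | H γ => ?_
    simp only [Finset.coe_filter, Finset.mem_univ, true_and, Set.mem_ofPred_eq] at hq
    rw [cosetCusp_mk_eq_iff hS hs, ← cuspMatrix_smul_infty s] at hq
    obtain ⟨δ, hδ, m, hm⟩ := exists_eq_mul_T_zpow_of_cuspEquiv hneg hq
    have hγ : γ = T ^ (-m) * (cuspMatrix s)⁻¹ * δ⁻¹ := by
      rw [← inv_inj, hm]; group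
    have hr0 := Int.emod_nonneg (-m) hpos'.ne'
    have hr1 := Int.emod_lt_of_pos (-m) hpos'
    refine ⟨((-m) % h).toNat, by simp; omega, ?_⟩
    rw [hγ, QuotientGroup.mk_mul_of_mem _ (Γ.inv_mem hδ), hmk, Int.toNat_of_nonneg hr0]
    exact Int.dvd_self_sub_emod

lemma sum_cosetCusp [Fintype (SL(2, ℤ) ⧸ Γ)] (hneg : (-1 : SL(2, ℤ)) ∈ Γ)
    (hS : IsCompleteSetOfCusps Γ S) (k : OnePoint ℚ → ℤ) :
    ∑ q : SL(2, ℤ) ⧸ Γ, (k (cosetCusp hS q) / fanWidth Γ (cuspMatrix (cosetCusp hS q)) : ℝ) =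
      ∑ s ∈ S, (k s : ℝ) := by
  classical
  rw [← Finset.sum_fiberwise_of_maps_to (s := Finset.univ) (t := S) (g := cosetCusp hS)
    fun q _ => cosetCusp_mem hS q]
  refine Finset.sum_congr rfl fun s hs => ?_
  have hpos : (fanWidth Γ (cuspMatrix s) : ℝ) ≠ 0 := by
    exact_mod_cast (fanWidth_spec hneg (cuspMatrix s)).1.ne'
  rw [Finset.sum_congr rfl (g := fun _ => (k s / fanWidth Γ (cuspMatrix s) : ℝ)) (by
    intro q hq
    rw [(Finset.mem_filter.1 hq).2]), Finset.sum_const, card_cosetCusp_fiber hneg hS hs,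
    nsmul_eq_mul, mul_div_cancel₀ _ hpos]

/-- The inequality half of the valence formula: `k s` is a lower bound for the order at `s`, and the
norm to level one turns a positive total into vanishing at `∞`. -/
lemma eq_zero_of_isBigO_exp_at_cusps (hneg : (-1 : SL(2, ℤ)) ∈ Γ)
    (hS : IsCompleteSetOfCusps Γ S) {g : ℍ → ℂ} (hg : MDiff g)
    (hinv : ∀ γ ∈ Γ, ∀ τ : ℍ, g (γ • τ) = g τ) (k : OnePoint ℚ → ℤ)
    (hk : ∀ s ∈ S, (fun τ => g (cuspMatrix s • τ)) =O[atImInfty]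
      fun τ => Real.exp (-2 * π * (k s / fanWidth Γ (cuspMatrix s)) * τ.im))
    (hpos : 0 < ∑ s ∈ S, k s) : g = 0 := by
  classical
  let : Fintype (SL(2, ℤ) ⧸ Γ) := Subgroup.fintypeQuotientOfFiniteIndex
  let F (q : SL(2, ℤ) ⧸ Γ) (τ : ℍ) : ℂ := g (q.out⁻¹ • τ)
  have hF (γ : SL(2, ℤ)) (τ : ℍ) : F γ τ = g (γ⁻¹ • τ) := by
    obtain ⟨δ, hδ⟩ := QuotientGroup.mk_out_eq_mul Γ γ
    simp only [F, hδ, mul_inv_rev, mul_smul]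
    exact hinv _ (Γ.inv_mem δ.2) _
  have hFdiff (q : SL(2, ℤ) ⧸ Γ) : MDiff (F q) :=
    hg.comp (mdifferentiable_smul (g := (q.out⁻¹ : SL(2, ℤ))) (by simp))
  -- `SL(2, ℤ)` permutes the factors, which makes the product invariant.
  have hFsmul (γ : SL(2, ℤ)) (q : SL(2, ℤ) ⧸ Γ) (τ : ℍ) : F q (γ • τ) = F (γ⁻¹ • q) τ := by
    induction q using QuotientGroup.induction_on with | H γ' => ?_
    have h1 : γ⁻¹ • (γ' : SL(2, ℤ) ⧸ Γ) = ((γ⁻¹ * γ' : SL(2, ℤ)) : SL(2, ℤ) ⧸ Γ) := rfl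
    rw [h1, hF, hF, ← mul_smul]
    simp
  have hFbound (q : SL(2, ℤ) ⧸ Γ) : F q =O[atImInfty] fun τ => Real.exp (-2 * π *
      (k (cosetCusp hS q) / fanWidth Γ (cuspMatrix (cosetCusp hS q))) * τ.im) := by
    have hs := cosetCusp_mem hS q
    have hq : CuspEquiv Γ (cosetCusp hS q) (mapGL ℚ q.out⁻¹ • OnePoint.infty) := by
      rw [← cosetCusp_mk_eq_iff hS hs, QuotientGroup.out_eq']
    rw [← cuspMatrix_smul_infty (cosetCusp hS q)] at hq
    obtain ⟨δ, hδ, m, hm⟩ := exists_eq_mul_T_zpow_of_cuspEquiv hneg hq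
    simpa only [F, hm] using isBigO_exp_mul_T_zpow_smul hinv hδ m (hk _ hs)
  have hGbound : (∏ q, F q) =O[atImInfty]
      fun τ => Real.exp (-2 * π * ((∑ s ∈ S, k s : ℤ) : ℝ) * τ.im) := by
    have := IsBigO.finsetProd (s := Finset.univ) fun q _ => hFbound q
    simp only [← Real.exp_sum, ← Finset.sum_mul, ← Finset.mul_sum,
      sum_cosetCusp hneg hS k] at this
    rw [Finset.prod_fn]
    simpa using this
  have hGzero : Tendsto (∏ q, F q) atImInfty (𝓝 0) := by
    refine hGbound.trans_tendsto (Real.tendsto_exp_atBot.comp ?_)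
    refine Tendsto.const_mul_atTop_of_neg ?_ tendsto_comap
    have : (0 : ℝ) < (∑ s ∈ S, k s : ℤ) := by exact_mod_cast hpos
    nlinarith [Real.pi_pos, mul_pos Real.pi_pos this]
  have hGinv (γ : SL(2, ℤ)) : (∏ q, F q) ∣[(0 : ℤ)] γ = ∏ q, F q := by
    ext τ
    rw [ModularForm.SL_slash_apply]
    simp only [Finset.prod_apply, hFsmul, neg_zero, zpow_zero, mul_one]
    exact Equiv.prod_comp (MulAction.toPerm γ⁻¹) fun q => F q τ
  let G : ModularForm 𝒮ℒ 0 :=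
    { toFun := ∏ q, F q
      slash_action_eq' := by
        rintro _ ⟨γ, rfl⟩
        exact hGinv γ
      holo' := MDifferentiable.prod fun q _ => hFdiff q
      bdd_at_cusps' := fun {c} hc => by
        rw [OnePoint.isBoundedAt_iff_forall_SL2Z hc]
        intro γ _
        rw [hGinv]
        exact hGzero.isBigO_one ℝ }
  obtain ⟨c, hc⟩ := ModularFormClass.levelOne_weight_zero_const G
  have hc' : (∏ q, F q) = Function.const ℍ c := hc
  have hc0 : c = 0 := by
    rw [hc'] at hGzero
    exact tendsto_nhds_unique tendsto_const_nhds hGzero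
  have hG0 : ∏ q, F q = 0 := by rw [hc', hc0]; rfl
  -- Holomorphic functions on `ℍ` have no zero divisors.
  obtain ⟨q, -, hq⟩ := (prod_eq_zero_iff fun q _ => hFdiff q).1 hG0
  ext τ
  have := congrFun hq (q.out • τ)
  simpa [F] using this

end Cusps

/-! ### Bounds for `g` at the cusps and the conclusion. -/

lemma isBigO_exp_of_le_meromorphicOrderAt_cuspExpansion {Γ : Subgroup SL(2, ℤ)} [Γ.FiniteIndex]
    (hneg : (-1 : SL(2, ℤ)) ∈ Γ) {f : ℍ → ℂ} (hinv : ∀ γ ∈ Γ, ∀ τ : ℍ, f (γ • τ) = f τ)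
    {γ : SL(2, ℤ)} (hF : MeromorphicAt (cuspExpansion Γ f γ) 0) {k : ℤ}
    (hk : (k : WithTop ℤ) ≤ meromorphicOrderAt (cuspExpansion Γ f γ) 0) :
    (fun τ => f (γ • τ)) =O[atImInfty]
      fun τ => Real.exp (-2 * π * (k / fanWidth Γ γ) * τ.im) := by
  obtain ⟨hpos, hmem⟩ := fanWidth_spec hneg γ
  refine isBigO_exp_of_le_meromorphicOrderAt_cuspFunction (by exact_mod_cast hpos)
    (fun τ => ?_) hF hk
  have h1 : ((fanWidth Γ γ : ℝ) +ᵥ τ : ℍ) = T ^ fanWidth Γ γ • τ := by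
    ext
    rw [← zpow_natCast, coe_T_zpow_smul_eq]
    simp [add_comm]
  rw [h1, ← hinv _ hmem (γ • τ), ← mul_smul, ← mul_smul]
  simp

lemma minORD_eq (Γ : Subgroup SL(2, ℤ)) {n : ℕ} (f : Fin n → ℍ → ℂ) (s : OnePoint ℚ) :
    (minORD Γ f s : WithTop ℤ) = min 0 (Finset.univ.inf fun j => ORD Γ (f j) s) :=
  WithTop.coe_untop _ _

lemma minORD_le_ORD (Γ : Subgroup SL(2, ℤ)) {n : ℕ} (f : Fin n → ℍ → ℂ) (s : OnePoint ℚ)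
    (j : Fin n) : (minORD Γ f s : WithTop ℤ) ≤ ORD Γ (f j) s := by
  rw [minORD_eq]
  exact (min_le_right _ _).trans (Finset.inf_le (Finset.mem_univ j))

lemma minORD_nonpos (Γ : Subgroup SL(2, ℤ)) {n : ℕ} (f : Fin n → ℍ → ℂ) (s : OnePoint ℚ) :
    minORD Γ f s ≤ 0 := by
  have h : (minORD Γ f s : WithTop ℤ) ≤ 0 := by
    rw [minORD_eq]
    exact min_le_left _ _
  exact_mod_cast h

lemma neg_one_mem_Gamma0 (N : ℕ) : (-1 : SL(2, ℤ)) ∈ CongruenceSubgroup.Gamma0 N := by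
  simp [CongruenceSubgroup.Gamma0_mem]

lemma meromorphicAt_cuspExpansion_linearCombination {Γ : Subgroup SL(2, ℤ)} {n : ℕ}
    {f : Fin n → ℍ → ℂ} (α : Fin n → ℂ) {g : ℍ → ℂ} (hg : ∀ τ, g τ = (∑ j, α j * f j τ) + 1)
    {γ : SL(2, ℤ)} (hf : ∀ j, MeromorphicAt (cuspExpansion Γ (f j) γ) 0) :
    MeromorphicAt (cuspExpansion Γ g γ) 0 := by
  have h : MeromorphicAt (fun z => (∑ j, α j * cuspExpansion Γ (f j) γ z) + 1) 0 :=
    (MeromorphicAt.fun_sum fun j _ => (MeromorphicAt.const (α j) 0).fun_mul (hf j)).fun_add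
      (MeromorphicAt.const 1 0)
  refine h.congr ?_
  filter_upwards [self_mem_nhdsWithin] with z hz
  have hz' : z ≠ 0 := hz
  simp only [cuspExpansion, cuspFunction, Function.Periodic.cuspFunction_eq_of_nonzero _ _ hz',
    Function.comp_apply, hg]

lemma isBigO_exp_minORD {Γ : Subgroup SL(2, ℤ)} [Γ.FiniteIndex]
    (hneg : (-1 : SL(2, ℤ)) ∈ Γ) {n : ℕ} {f : Fin n → ℍ → ℂ}
    (hf : ∀ j, IsModularFunction Γ (f j)) (α : Fin n → ℂ) {g : ℍ → ℂ}
    (hg : ∀ τ, g τ = (∑ j, α j * f j τ) + 1) (s : OnePoint ℚ) :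
    (fun τ => g (cuspMatrix s • τ)) =O[atImInfty]
      fun τ => Real.exp (-2 * π * (minORD Γ f s / fanWidth Γ (cuspMatrix s)) * τ.im) := by
  simp only [hg]
  refine (IsBigO.fun_sum fun j _ => IsBigO.const_mul_left ?_ _).add ?_
  · exact isBigO_exp_of_le_meromorphicOrderAt_cuspExpansion hneg (hf j).invariant
      ((hf j).meromorphic_cusps _) (minORD_le_ORD Γ f s j)
  -- The summand `1` has order `0`; this is why `0` enters the minimum.
  · refine IsBigO.of_bound 1 (Eventually.of_forall fun τ => ?_)
    have h0 : (minORD Γ f s : ℝ) ≤ 0 := by exact_mod_cast minORD_nonpos Γ f s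
    have h1 : (minORD Γ f s / fanWidth Γ (cuspMatrix s) : ℝ) ≤ 0 :=
      div_nonpos_of_nonpos_of_nonneg h0 (Nat.cast_nonneg _)
    rw [norm_one, one_mul, Real.norm_eq_abs, Real.abs_exp]
    refine Real.one_le_exp (mul_nonneg ?_ τ.im_pos.le)
    nlinarith [Real.pi_pos]

lemma ORD_eq_top_of_eq_zero (Γ : Subgroup SL(2, ℤ)) {g : ℍ → ℂ} (hg : ∀ τ, g τ = 0)
    (s : OnePoint ℚ) : ORD Γ g s = ⊤ := by
  rw [ORD, meromorphicOrderAt_eq_top_iff]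
  filter_upwards [self_mem_nhdsWithin] with z hz
  have hz' : z ≠ 0 := hz
  simp only [cuspExpansion, cuspFunction, Function.Periodic.cuspFunction_eq_of_nonzero _ _ hz',
    Function.comp_apply, hg]

lemma eq_zero_of_neg_boundB_lt_ORD {Γ : Subgroup SL(2, ℤ)} [Γ.FiniteIndex]
    (hneg : (-1 : SL(2, ℤ)) ∈ Γ) {S : Finset (OnePoint ℚ)} (hS : IsCompleteSetOfCusps Γ S)
    {n : ℕ} {f : Fin n → ℍ → ℂ} (hf : ∀ j, IsModularFunction Γ (f j))
    (hdiff : ∀ j, MDiff (f j)) (α : Fin n → ℂ) {g : ℍ → ℂ}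
    (hg : ∀ τ, g τ = (∑ j, α j * f j τ) + 1)
    (hord : ((-boundB Γ S f : ℤ) : WithTop ℤ) < ORD Γ g OnePoint.infty) : g = 0 := by
  classical
  have hinv : ∀ γ ∈ Γ, ∀ τ : ℍ, g (γ • τ) = g τ := fun γ hγ τ => by
    simp only [hg, (hf _).invariant γ hγ]
  have hgdiff : MDiff g := by
    have h : g = (∑ j, (fun _ => α j) * f j) + fun _ => 1 := by
      ext τ
      simp [hg]
    rw [h]
    exact (MDifferentiable.sum fun j _ => mdifferentiable_const.mul (hdiff j)).add
      mdifferentiable_const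
  have hord' : ((1 - boundB Γ S f : ℤ) : WithTop ℤ) ≤ ORD Γ g OnePoint.infty := by
    generalize ORD Γ g OnePoint.infty = o at hord
    cases o with
    | top => exact le_top
    | coe o =>
      have := WithTop.coe_lt_coe.1 hord
      exact WithTop.coe_le_coe.2 (by omega)
  have hinfty := isBigO_exp_of_le_meromorphicOrderAt_cuspExpansion hneg hinv
    (meromorphicAt_cuspExpansion_linearCombination α hg
      fun j => (hf j).meromorphic_cusps (cuspMatrix OnePoint.infty)) hord'
  refine eq_zero_of_isBigO_exp_at_cusps hneg hS hgdiff hinv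
    -- Exactly one `s ∈ S` is equivalent to `∞`, so these orders add up to `(1 - B) + B = 1`.
    (fun s => if CuspEquiv Γ s OnePoint.infty then 1 - boundB Γ S f else minORD Γ f s)
    (fun s _ => ?_) ?_
  · by_cases hs : CuspEquiv Γ s OnePoint.infty
    · simp only [hs, if_true]
      -- The representative `s` need not be `∞` itself, so the bound is carried from `cuspMatrix ∞`
      -- to `cuspMatrix s`.
      have hs' : CuspEquiv Γ (mapGL ℚ (cuspMatrix OnePoint.infty) • OnePoint.infty)
          (mapGL ℚ (cuspMatrix s) • OnePoint.infty) := by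
        simpa only [cuspMatrix_smul_infty] using hs.symm
      obtain ⟨δ, hδ, m, hm⟩ := exists_eq_mul_T_zpow_of_cuspEquiv hneg hs'
      rw [hm, fanWidth_mul_T_zpow hδ hneg]
      exact isBigO_exp_mul_T_zpow_smul hinv hδ m hinfty
    · simp only [hs, if_false]
      exact isBigO_exp_minORD hneg hf α hg s
  · obtain ⟨s₀, hs₀, huniq⟩ := hS OnePoint.infty
    have hfilter : S.filter (fun s => CuspEquiv Γ s OnePoint.infty) = {s₀} := by
      ext s
      simp only [Finset.mem_filter, Finset.mem_singleton]
      exact ⟨huniq s, fun h => h ▸ hs₀⟩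
    rw [Finset.sum_ite, hfilter, Finset.sum_singleton]
    have hB : boundB Γ S f = ∑ s ∈ S with ¬ CuspEquiv Γ s OnePoint.infty, minORD Γ f s := by
      rw [boundB]
    rw [← hB]
    omega

end EtaProducts

theorem mainTheorem1 (N : ℕ) (hN : 0 < N) (S : Finset (OnePoint ℚ))
    (hS : EtaProducts.IsCompleteSetOfCusps (CongruenceSubgroup.Gamma0 N) S)
    (n : ℕ) (f : Fin n → ℍ → ℂ)
    (hf : ∀ j, EtaProducts.IsEtaProduct (f j))
    (hmod : ∀ j, EtaProducts.IsModularFunction (CongruenceSubgroup.Gamma0 N) (f j))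
    (α : Fin n → ℂ) (g : ℍ → ℂ) (hg : ∀ τ, g τ = (∑ j, α j * f j τ) + 1) :
    (∀ τ, g τ = 0) ↔
      EtaProducts.ORD (CongruenceSubgroup.Gamma0 N) g OnePoint.infty >
        ((-EtaProducts.boundB (CongruenceSubgroup.Gamma0 N) S f : ℤ) : WithTop ℤ) := by
  have : NeZero N := ⟨hN.ne'⟩
  refine ⟨fun h => ?_, fun h => ?_⟩
  · rw [EtaProducts.ORD_eq_top_of_eq_zero _ h]
    exact WithTop.coe_lt_top _
  · refine congrFun (EtaProducts.eq_zero_of_neg_boundB_lt_ORD (EtaProducts.neg_one_mem_Gamma0 N)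
      hS hmod (fun j => ?_) α hg h)
    obtain ⟨m, hm⟩ := hf j
    rw [hm]
    exact EtaProducts.mdifferentiable_etaProduct m
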